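/- Let $n\ge 0$ be an integer and let $\zeta_1,\dots,\zeta_{2n}$ be distinct complex numbers. Then there are only finitely many tuples $(P,Q,z_1,\dots,z_{2n})$ consisting of polynomials with complex coefficients of the form $$P(z)=z^{n+1}+\sum_{k=0}^{n-1}p_kz^k,\qquad Q(z)=z^n+\sum_{k=0}^{n-1}q_kz^k$$ and points $z_1,\dots,z_{2n}\in\mathbb{C}$ such that, for every $j=1,\dots,2n$, $$P(z_j)-\zeta_jQ(z_j)=0,\qquad P'(z_j)Q(z_j)-P(z_j)Q'(z_j)=0,\qquad Q(z_j)\neq 0.$$ -/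

import Mathlib

open Polynomial

/-- `(P, Q, z)` solves the polynomial form of the critical value problem for the prescribed
values `ζ 0, …, ζ (2n-1)`: one has `P = X^(n+1) + p_{n-1} X^(n-1) + ⋯ + p_0` and
`Q = X^n + q_{n-1} X^(n-1) + ⋯ + q_0`, and each `z j` satisfies
`P(z j) - ζ j * Q(z j) = 0` and `P'(z j) Q(z j) - P(z j) Q'(z j) = 0`. -/
structure IsCritValSolution (n : ℕ) (ζ : Fin (2 * n) → ℂ)
    (P Q : ℂ[X]) (z : Fin (2 * n) → ℂ) : Prop where
  monic_P : P.Monic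
  natDegree_P : P.natDegree = n + 1
  coeff_P : P.coeff n = 0
  monic_Q : Q.Monic
  natDegree_Q : Q.natDegree = n
  critVal : ∀ j, P.eval (z j) - ζ j * Q.eval (z j) = 0
  critPt : ∀ j, (derivative P).eval (z j) * Q.eval (z j)
    - P.eval (z j) * (derivative Q).eval (z j) = 0

/-! The coefficients, the `z j` and the inverses of `Q(z j)` are functions on the solution set that
separate its points. They generate a finite type algebra `A`; if its derivations into residue fields
vanish, `A` is unramified, hence finite-dimensional, and has finitely many characters to `ℂ`.

A derivation is a first order deformation `(Pd, Qd, zd)` with fixed critical values. Then `Pd * Q -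
P * Qd` has degree at most `2n` and vanishes at the `2n` distinct zeros of `W = P' * Q - P * Q'`, so
it equals `c * W`. Coprimality gives `Pd = c * P'`, `Qd = c * Q'`, an infinitesimal translation,
which the normalization of `P` excludes (`deformation_eq_zero`). The `z j` are simple zeros of `W`,
so they do not move either. -/

/-- A finite type algebra all of whose derivations into fields vanish is unramified. -/
theorem Algebra.FormallyUnramified.of_derivation_field_eq_zero {R A : Type*} [CommRing R]
    [CommRing A] [Algebra R A] [Algebra.FiniteType R A]
    (h : ∀ (m : Ideal A) [m.IsMaximal] (D : Derivation R A (A ⧸ m)), D = 0) :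
    Algebra.FormallyUnramified R A := by
  refine ⟨?_⟩
  by_contra hne
  rw [not_subsingleton_iff_nontrivial] at hne
  -- A nonzero finite module has a simple quotient `A ⧸ m`; projecting the universal derivation to
  -- it gives a nonzero derivation.
  obtain ⟨N, hN, -⟩ := (eq_top_or_exists_le_coatom (⊥ : Submodule A (Ω[A⁄R]))).resolve_left bot_ne_top
  have hs := isSimpleModule_iff_isCoatom.2 hN
  obtain ⟨m, hm, ⟨e⟩⟩ := isSimpleModule_iff_quot_maximal.1 hs
  let f : Ω[A⁄R] →ₗ[A] (A ⧸ m) := e.toLinearMap ∘ₗ N.mkQ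
  have hf : f = 0 := by
    have h0 := h m (f.compDer (KaehlerDifferential.D R A))
    ext x
    exact DFunLike.congr_fun h0 x
  refine hN.1 (Submodule.eq_top_iff'.2 fun x => ?_)
  have hx : e (N.mkQ x) = 0 := LinearMap.congr_fun hf x
  simpa using hx

/-- A set of points separated by finitely many complex functions is finite as soon as all
derivations of the algebra generated by these functions into fields vanish. -/
theorem finite_of_derivation_coordinates_eq_zero {S ι : Type} [Finite ι] (F : ι → S → ℂ)
    (hF : ∀ s t, (∀ i, F i s = F i t) → s = t)
    (h : ∀ (K : Type) [Field K] [CharZero K]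
      [Algebra (Algebra.adjoin ℂ (Set.range F)) K] [Algebra ℂ K]
      [IsScalarTower ℂ (Algebra.adjoin ℂ (Set.range F)) K]
      (D : Derivation ℂ (Algebra.adjoin ℂ (Set.range F)) K) (i : ι),
      D ⟨F i, Algebra.subset_adjoin ⟨i, rfl⟩⟩ = 0) : Finite S := by
  let A := Algebra.adjoin ℂ (Set.range F)
  have hft : Algebra.FiniteType ℂ A :=
    (Subalgebra.fg_iff_finiteType _).1 (Subalgebra.fg_def.2 ⟨_, Set.finite_range F, rfl⟩)
  have hur : Algebra.FormallyUnramified ℂ A := by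
    refine .of_derivation_field_eq_zero fun m hm D => ?_
    let _ : Field (A ⧸ m) := Ideal.Quotient.field m
    have : CharZero (A ⧸ m) :=
      charZero_of_injective_algebraMap (algebraMap ℂ (A ⧸ m)).injective
    refine Derivation.ext_of_adjoin_eq_top (((↑) : A → S → ℂ) ⁻¹' Set.range F)
      (Algebra.adjoin_adjoin_coe_preimage) ?_
    rintro ⟨_, _⟩ ⟨i, rfl⟩
    exact h (A ⧸ m) D i
  have hfin : Module.Finite ℂ A := Algebra.FormallyUnramified.finite_of_free ℂ A
  refine Finite.of_injective
    (fun s => ((Pi.evalAlgHom ℂ (fun _ : S => ℂ) s).comp A.val : A →ₐ[ℂ] ℂ)) fun s t hst => ?_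
  exact hF s t fun i => DFunLike.congr_fun hst ⟨F i, Algebra.subset_adjoin ⟨i, rfl⟩⟩

/-! ### Derivations and polynomial evaluation -/

namespace Derivation

variable {R A K : Type*} [CommRing R] [CommRing A] [Algebra R A] [CommRing K] [Algebra A K]
  [Algebra R K]

/-- Apply a derivation to the coefficients of a polynomial. -/
noncomputable def coeffwise (D : Derivation R A K) (f : A[X]) : K[X] :=
  f.sum fun k a => monomial k (D a)

theorem coeff_coeffwise (D : Derivation R A K) (f : A[X]) (k : ℕ) :
    (D.coeffwise f).coeff k = D (f.coeff k) := by
  classical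
  rw [coeffwise, sum_def, finsetSum_coeff]
  simp only [coeff_monomial, Finset.sum_ite_eq']
  split_ifs with h
  · rfl
  · rw [notMem_support_iff.1 h, D.map_zero]

theorem coeffwise_derivative (D : Derivation R A K) (f : A[X]) :
    D.coeffwise (derivative f) = derivative (D.coeffwise f) := by
  ext k
  simp only [coeff_coeffwise, coeff_derivative]
  rw [D.leibniz, D.map_add, D.map_natCast, D.map_one_eq_zero, add_zero, smul_zero, zero_add,
    Algebra.smul_def, map_add, _root_.map_natCast, map_one, mul_comm]

/-- The chain rule; it linearizes the equations of a solution. -/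
theorem map_eval (D : Derivation R A K) (f : A[X]) (a : A) :
    D (f.eval a) = (D.coeffwise f).eval (algebraMap A K a)
      + ((derivative f).map (algebraMap A K)).eval (algebraMap A K a) * D a := by
  induction f using Polynomial.induction_on' with
  | add f g hf hg =>
    have hadd : D.coeffwise (f + g) = D.coeffwise f + D.coeffwise g := by
      ext k
      simp [coeff_coeffwise]
    rw [eval_add, D.map_add, hf, hg, hadd]
    simp only [derivative_add, Polynomial.map_add, eval_add]
    ring
  | monomial k c =>
    have hmon : D.coeffwise (monomial k c) = monomial k (D c) := by
      ext i
      rw [coeff_coeffwise, coeff_monomial, coeff_monomial]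
      split_ifs <;> simp
    rw [hmon, eval_monomial, D.leibniz, D.leibniz_pow, derivative_monomial, map_monomial,
      eval_monomial, eval_monomial]
    simp only [nsmul_eq_mul, Algebra.smul_def (A := K) (R := A), map_mul, map_pow,
      _root_.map_natCast]
    ring

end Derivation

/-! ### Infinitesimal rigidity over a field -/

section Rigidity

variable {K : Type*} [Field K] {n : ℕ}
  {P Q : K[X]} {ζ z : Fin (2 * n) → K}

/-- The critical points are distinct since the critical values are. -/
theorem critPt_injective (hζ : Function.Injective ζ) (hQz : ∀ j, Q.eval (z j) ≠ 0)
    (hval : ∀ j, P.eval (z j) - ζ j * Q.eval (z j) = 0) : Function.Injective z := by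
  intro i j hij
  have hi := hval i
  have hj := hval j
  rw [hij] at hi
  exact hζ (mul_right_cancel₀ (hQz j) (by linear_combination hj - hi))

theorem coeff_wronskian (hP : P.Monic) (hPn : P.natDegree = n + 1) (hQ : Q.Monic)
    (hQn : Q.natDegree = n) : (derivative P * Q - P * derivative Q).coeff (2 * n) = 1 := by
  have hPc : P.coeff (n + 1) = 1 := hPn ▸ hP.coeff_natDegree
  have hQc : Q.coeff n = 1 := by
    have := hQ.coeff_natDegree
    rwa [hQn] at this
  have h1 : (derivative P * Q).coeff (n + n) = n + 1 := by
    rw [coeff_mul_add_eq_of_natDegree_le ((natDegree_derivative_le P).trans (by omega)) hQn.le,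
      coeff_derivative, hPc, hQc]
    ring
  have h2 : (P * derivative Q).coeff (n + n) = n := by
    -- `n = 0` is separate because the degree bound `n - 1` on `Q'` truncates.
    obtain _ | m := n
    · rw [Polynomial.eq_one_of_monic_natDegree_zero hQ hQn]
      simp
    · rw [show m + 1 + (m + 1) = (m + 1 + 1) + m by ring,
        coeff_mul_add_eq_of_natDegree_le hPn.le ((natDegree_derivative_le Q).trans (by omega)),
        coeff_derivative, hPc, hQc]
      push_cast
      ring
  rw [coeff_sub, two_mul, h1, h2]
  ring

theorem natDegree_wronskian_le (hPn : P.natDegree = n + 1)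
    (hQn : Q.natDegree = n) : (derivative P * Q - P * derivative Q).natDegree ≤ 2 * n := by
  refine (natDegree_sub_le_of_le (m := 2 * n) (n := 2 * n) ?_ ?_).trans (by simp)
  · have := natDegree_derivative_le P
    exact natDegree_mul_le.trans (by omega)
  · obtain _ | m := n
    · rw [eq_C_of_natDegree_eq_zero hQn]
      simp
    · have := natDegree_derivative_le Q
      exact natDegree_mul_le.trans (by omega)

/-- The Wronskian is the nodal polynomial of the critical points. -/
theorem wronskian_eq_nodal (hP : P.Monic) (hPn : P.natDegree = n + 1) (hQ : Q.Monic)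
    (hQn : Q.natDegree = n) (hz : Function.Injective z)
    (hcrit : ∀ j, (derivative P).eval (z j) * Q.eval (z j)
      - P.eval (z j) * (derivative Q).eval (z j) = 0) :
    derivative P * Q - P * derivative Q = Lagrange.nodal Finset.univ z := by
  have hc := coeff_wronskian hP hPn hQ hQn
  have hle := natDegree_wronskian_le hPn hQn
  have hdeg : (derivative P * Q - P * derivative Q).natDegree = 2 * n :=
    natDegree_eq_of_le_of_coeff_ne_zero hle (by rw [hc]; exact one_ne_zero)
  have hmon : (derivative P * Q - P * derivative Q).Monic := by
    rw [Monic, leadingCoeff, hdeg, hc]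
  refine sub_eq_zero.1 (eq_zero_of_degree_lt_of_eval_index_eq_zero Finset.univ hz.injOn ?_ ?_)
  · have hd : (derivative P * Q - P * derivative Q).degree = (2 * n : ℕ) := by
      rw [degree_eq_natDegree hmon.ne_zero, hdeg]
    have hd' : (Lagrange.nodal Finset.univ z).degree = (2 * n : ℕ) := by
      rw [Lagrange.degree_nodal, Finset.card_univ, Fintype.card_fin]
    refine (degree_sub_lt_left (hd.trans hd'.symm) hmon.ne_zero ?_).trans_eq ?_
    · rw [hmon.leadingCoeff, Lagrange.nodal_monic.leadingCoeff]
    · rw [hd, Finset.card_univ, Fintype.card_fin]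
  · intro j _
    rw [eval_sub, Lagrange.eval_nodal_at_node (Finset.mem_univ j), eval_sub, eval_mul, eval_mul,
      hcrit j, sub_zero]

/-- Polynomials with squarefree Wronskian are coprime. -/
theorem isCoprime_of_squarefree_wronskian
    (h : Squarefree (derivative P * Q - P * derivative Q)) : IsCoprime P Q := by
  rw [← isRelPrime_iff_isCoprime]
  -- The square of a common factor divides the Wronskian.
  rintro d ⟨p, rfl⟩ ⟨q, rfl⟩
  refine h d ⟨derivative p * q - p * derivative q, ?_⟩
  simp only [derivative_mul]
  ring

/-- A first order deformation of a solution keeping the critical values fixed has trivial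
numerator and denominator. -/
theorem deformation_eq_zero [CharZero K] {Pd Qd : K[X]} {zd : Fin (2 * n) → K}
    (hζ : Function.Injective ζ)
    (hP : P.Monic) (hPn : P.natDegree = n + 1) (hQ : Q.Monic) (hQn : Q.natDegree = n)
    (hQz : ∀ j, Q.eval (z j) ≠ 0)
    (hval : ∀ j, P.eval (z j) - ζ j * Q.eval (z j) = 0)
    (hcrit : ∀ j, (derivative P).eval (z j) * Q.eval (z j)
      - P.eval (z j) * (derivative Q).eval (z j) = 0)
    (hPd : Pd.degree < n) (hQd : Qd.degree < n)
    (hval' : ∀ j, Pd.eval (z j) + (derivative P).eval (z j) * zd j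
      - ζ j * (Qd.eval (z j) + (derivative Q).eval (z j) * zd j) = 0) :
    Pd = 0 ∧ Qd = 0 := by
  have hz := critPt_injective hζ hQz hval
  have hW := wronskian_eq_nodal hP hPn hQ hQn hz hcrit
  have hcop : IsCoprime P Q := by
    refine isCoprime_of_squarefree_wronskian ?_
    rw [hW, Lagrange.nodal]
    exact (separable_prod_X_sub_C_iff.2 hz).squarefree
  have hQdeg : Q.degree = n := by rw [degree_eq_natDegree hQ.ne_zero, hQn]
  obtain _ | m := n
  · exact ⟨by simpa using hPd, by simpa using hQd⟩
  have hPd' : Pd.natDegree ≤ m :=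
    natDegree_le_iff_coeff_eq_zero.2 fun k hk => (degree_lt_iff_coeff_zero _ _).1 hPd k hk
  have hQd' : Qd.natDegree ≤ m :=
    natDegree_le_iff_coeff_eq_zero.2 fun k hk => (degree_lt_iff_coeff_zero _ _).1 hQd k hk
  set W := derivative P * Q - P * derivative Q with hWdef
  -- As `W` is monic of degree `2n`, this `c` cancels the top coefficient.
  set c := (Pd * Q - P * Qd).coeff (2 * (m + 1)) with hc
  have hU : Pd * Q - P * Qd - C c * W = 0 := by
    refine eq_zero_of_degree_lt_of_eval_index_eq_zero Finset.univ hz.injOn ?_ fun j _ => ?_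
    · rw [Finset.card_univ, Fintype.card_fin, degree_lt_iff_coeff_zero]
      intro k hk
      rcases hk.eq_or_lt with rfl | hk
      · rw [coeff_sub, coeff_C_mul, coeff_wronskian hP hPn hQ hQn, mul_one, hc, sub_self]
      · refine coeff_eq_zero_of_natDegree_lt (lt_of_le_of_lt ?_ hk)
        refine (natDegree_sub_le_of_le (m := 2 * (m + 1)) (n := 2 * (m + 1))
          ((natDegree_sub_le_of_le (m := 2 * (m + 1)) (n := 2 * (m + 1))
            (natDegree_mul_le.trans (by omega)) (natDegree_mul_le.trans (by omega))).trans
              (by simp))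
          ((natDegree_C_mul_le _ _).trans (natDegree_wronskian_le hPn hQn))).trans (by simp)
    -- Since `P' = ζ j * Q'` at `z j`, the unknown `zd j` drops out of `hval'`.
    · have h1 : (derivative P).eval (z j) = ζ j * (derivative Q).eval (z j) :=
        mul_right_cancel₀ (hQz j)
          (by linear_combination hcrit j + (derivative Q).eval (z j) * hval j)
      have hWj : W.eval (z j) = 0 := by
        rw [hWdef, eval_sub, eval_mul, eval_mul, hcrit j]
      rw [eval_sub, eval_mul, hWj, mul_zero, sub_zero, eval_sub, eval_mul, eval_mul]
      linear_combination Q.eval (z j) * hval' j - Q.eval (z j) * zd j * h1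
        - Qd.eval (z j) * hval j
  have hfac : (Pd - C c * derivative P) * Q = P * (Qd - C c * derivative Q) := by
    rw [hWdef] at hU
    linear_combination hU
  have hQ0 : Qd - C c * derivative Q = 0 := by
    refine eq_zero_of_dvd_of_degree_lt
      (hcop.symm.dvd_of_dvd_mul_left ⟨Pd - C c * derivative P, by rw [← hfac, mul_comm]⟩)
      ((degree_sub_le _ _).trans_lt (max_lt (hQdeg.symm ▸ hQd) ?_))
    rw [C_mul']
    exact (degree_smul_le _ _).trans_lt (degree_derivative_lt hQ.ne_zero)
  have hP0 : Pd - C c * derivative P = 0 := by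
    rw [hQ0, mul_zero] at hfac
    exact (mul_eq_zero.1 hfac).resolve_right hQ.ne_zero
  -- Compare coefficients of degree `m + 1 = n`: `Pd` has none, while `c * P'` has `c * (n + 1)`.
  have hc0 : c = 0 := by
    have h := congrArg (fun f => f.coeff (m + 1)) hP0
    simp only [coeff_sub, coeff_C_mul, coeff_derivative, coeff_zero] at h
    have hPc : P.coeff (m + 1 + 1) = 1 := hPn ▸ hP.coeff_natDegree
    rw [coeff_eq_zero_of_natDegree_lt (by omega), hPc, one_mul, zero_sub, neg_eq_zero] at h
    exact (mul_eq_zero.1 h).resolve_right (Nat.cast_add_one_ne_zero (m + 1))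
  rw [hc0, C_0, zero_mul, sub_zero] at hP0 hQ0
  exact ⟨hP0, hQ0⟩

end Rigidity

/-! ### Normal forms and vanishing of derivations -/

theorem monic_X_pow_add_sum_fin {R : Type*} [CommRing R] [Nontrivial R] {n m : ℕ} (hnm : n ≤ m)
    (a : Fin n → R) : (X ^ m + ∑ k : Fin n, C (a k) * X ^ (k : ℕ)).Monic ∧
      (X ^ m + ∑ k : Fin n, C (a k) * X ^ (k : ℕ)).natDegree = m := by
  have h : (∑ k : Fin n, C (a k) * X ^ (k : ℕ)).degree < (m : WithBot ℕ) :=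
    (degree_sum_fin_lt a).trans_le (by exact_mod_cast hnm)
  refine ⟨monic_X_pow_add h, natDegree_eq_of_degree_eq_some ?_⟩
  rw [degree_add_eq_left_of_degree_lt (by rwa [degree_X_pow]), degree_X_pow]

theorem eq_X_pow_add_sum_fin {R : Type*} [CommRing R] {n m : ℕ} {f : R[X]}
    (hf : f.Monic) (hm : f.natDegree = m) (hnm : n ≤ m)
    (h : ∀ k, n ≤ k → k < m → f.coeff k = 0) :
    f = X ^ m + ∑ k : Fin n, C (f.coeff k) * X ^ (k : ℕ) := by
  conv_lhs => rw [hf.as_sum, hm]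
  rw [Fin.sum_univ_eq_sum_range (fun k => C (f.coeff k) * X ^ k) n]
  congr 1
  symm
  refine Finset.sum_subset (Finset.range_mono hnm) fun k hk hk' => ?_
  rw [h k (by simpa using hk') (by simpa using hk), C_0, zero_mul]

theorem Derivation.coeffwise_X_pow_add_sum_fin {R A K : Type*} [CommRing R] [CommRing A]
    [Algebra R A] [CommRing K] [Algebra A K] [Algebra R K] (D : Derivation R A K) {n : ℕ} (m : ℕ)
    (a : Fin n → A) :
    D.coeffwise (X ^ m + ∑ k : Fin n, C (a k) * X ^ (k : ℕ)) =
      ∑ k : Fin n, C (D (a k)) * X ^ (k : ℕ) := by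
  ext i
  simp only [coeff_coeffwise, coeff_add, finsetSum_coeff, coeff_C_mul, coeff_X_pow, map_add,
    map_sum, mul_ite, mul_one, mul_zero]
  rw [apply_ite D, D.map_one_eq_zero, D.map_zero, ite_self, zero_add]
  refine Finset.sum_congr rfl fun k _ => ?_
  split_ifs <;> simp

/-- In an algebra over a characteristic zero field, derivations vanish on the data of a solution
with constant critical values. -/
theorem derivation_eq_zero_of_critVal {k A K : Type*} [Field k] [CommRing A] [Algebra k A]
    [Field K] [CharZero K] [Algebra A K] [Algebra k K] [IsScalarTower k A K] {n : ℕ}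
    {ζ : Fin (2 * n) → k} (hζ : Function.Injective ζ)
    (p q : Fin n → A) (z u : Fin (2 * n) → A) {P Q : A[X]}
    (hP : P = X ^ (n + 1) + ∑ k : Fin n, C (p k) * X ^ (k : ℕ))
    (hQ : Q = X ^ n + ∑ k : Fin n, C (q k) * X ^ (k : ℕ))
    (hu : ∀ j, u j * Q.eval (z j) = 1)
    (hval : ∀ j, P.eval (z j) - algebraMap k A (ζ j) * Q.eval (z j) = 0)
    (hcrit : ∀ j, (derivative P).eval (z j) * Q.eval (z j)
      - P.eval (z j) * (derivative Q).eval (z j) = 0) (D : Derivation k A K) :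
    (∀ i, D (p i) = 0) ∧ (∀ i, D (q i) = 0) ∧ (∀ j, D (z j) = 0) ∧ ∀ j, D (u j) = 0 := by
  set φ := algebraMap A K with hφ
  have hev (f : A[X]) (a : A) : φ (f.eval a) = (f.map φ).eval (φ a) := by
    rw [eval_map, eval₂_at_apply]
  obtain ⟨hPm, hPn⟩ : (P.map φ).Monic ∧ (P.map φ).natDegree = n + 1 := by
    have h := monic_X_pow_add_sum_fin (Nat.le_succ n) fun i => φ (p i)
    simpa [hP, Polynomial.map_sum] using h
  obtain ⟨hQm, hQn⟩ : (Q.map φ).Monic ∧ (Q.map φ).natDegree = n := by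
    have h := monic_X_pow_add_sum_fin le_rfl fun i => φ (q i)
    simpa [hQ, Polynomial.map_sum] using h
  have hPd : D.coeffwise P = ∑ k : Fin n, C (D (p k)) * X ^ (k : ℕ) := by
    rw [hP, D.coeffwise_X_pow_add_sum_fin]
  have hQd : D.coeffwise Q = ∑ k : Fin n, C (D (q k)) * X ^ (k : ℕ) := by
    rw [hQ, D.coeffwise_X_pow_add_sum_fin]
  have hζ' : Function.Injective fun j => φ (algebraMap k A (ζ j)) := by
    intro i j hij
    simp only [hφ, ← IsScalarTower.algebraMap_apply] at hij
    exact hζ ((algebraMap k K).injective hij)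
  have hQz (j) : (Q.map φ).eval (φ (z j)) ≠ 0 := by
    rw [← hev]
    refine right_ne_zero_of_mul (a := φ (u j)) ?_
    rw [← map_mul, hu, map_one]
    exact one_ne_zero
  have hval₁ (j) : (P.map φ).eval (φ (z j))
      - φ (algebraMap k A (ζ j)) * (Q.map φ).eval (φ (z j)) = 0 := by
    rw [← hev, ← hev, ← map_mul, ← map_sub, hval, map_zero]
  have hcrit₁ (j) : (derivative (P.map φ)).eval (φ (z j)) * (Q.map φ).eval (φ (z j))
      - (P.map φ).eval (φ (z j)) * (derivative (Q.map φ)).eval (φ (z j)) = 0 := by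
    have h := congrArg φ (hcrit j)
    rwa [map_sub, map_mul, map_mul, hev, hev, hev, hev, map_zero, ← derivative_map,
      ← derivative_map] at h
  have hval₂ (j) : (D.coeffwise P).eval (φ (z j)) + (derivative (P.map φ)).eval (φ (z j)) * D (z j)
      - φ (algebraMap k A (ζ j)) * ((D.coeffwise Q).eval (φ (z j))
        + (derivative (Q.map φ)).eval (φ (z j)) * D (z j)) = 0 := by
    have h := congrArg D (hval j)
    rw [map_sub, D.leibniz, D.map_algebraMap, smul_zero, add_zero, D.map_eval, D.map_eval,
      map_zero, Algebra.smul_def] at h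
    rwa [derivative_map, derivative_map]
  obtain ⟨hP0, hQ0⟩ := deformation_eq_zero hζ' hPm hPn hQm hQn hQz hval₁ hcrit₁
    (hPd ▸ degree_sum_fin_lt _) (hQd ▸ degree_sum_fin_lt _) hval₂
  have hcoeff (a : Fin n → K) (h : ∑ k : Fin n, C (a k) * X ^ (k : ℕ) = 0) (i) : a i = 0 := by
    have h := congrArg (fun f => f.coeff (i : ℕ)) h
    simpa [finsetSum_coeff, coeff_X_pow, Fin.val_inj] using h
  -- With `P` and `Q` fixed, differentiating `W(z j) = 0` leaves `W'(z j) * D (z j) = 0`, and `z j`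
  -- is a simple zero.
  have hz0 (j) : D (z j) = 0 := by
    have h := congrArg D (hcrit j)
    rw [map_sub, D.leibniz, D.leibniz, D.map_eval, D.map_eval, D.map_eval, D.map_eval,
      D.coeffwise_derivative, D.coeffwise_derivative, hP0, hQ0, D.map_zero] at h
    simp only [Algebra.smul_def, derivative_zero, eval_zero, zero_add, ← hφ, hev] at h
    have hinj := critPt_injective hζ' hQz hval₁
    have hW := wronskian_eq_nodal hPm hPn hQm hQn hinj hcrit₁
    have hne : (derivative (Lagrange.nodal Finset.univ fun j => φ (z j))).eval (φ (z j)) ≠ 0 := by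
      rw [Lagrange.eval_nodal_derivative_eval_node_eq (v := fun j => φ (z j)) (Finset.mem_univ j)]
      exact Lagrange.eval_nodal_not_at_node fun i hi =>
        hinj.ne (Finset.ne_of_mem_erase hi).symm
    refine (mul_eq_zero.1 ?_).resolve_left hne
    rw [← hW]
    simp only [derivative_sub, derivative_mul, eval_sub, eval_add, eval_mul, derivative_map]
    linear_combination h
  refine ⟨hcoeff _ (hPd ▸ hP0), hcoeff _ (hQd ▸ hQ0), hz0, fun j => ?_⟩
  rw [D.leibniz_of_mul_eq_one (hu j), D.map_eval, hQ0, hz0]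
  simp

theorem mainTheorem3 (n : ℕ) (ζ : Fin (2 * n) → ℂ) (hζ : Function.Injective ζ) :
    {s : ℂ[X] × ℂ[X] × (Fin (2 * n) → ℂ) |
      IsCritValSolution n ζ s.1 s.2.1 s.2.2 ∧ ∀ j, s.2.1.eval (s.2.2 j) ≠ 0}.Finite := by
  set S := {s : ℂ[X] × ℂ[X] × (Fin (2 * n) → ℂ) |
      IsCritValSolution n ζ s.1 s.2.1 s.2.2 ∧ ∀ j, s.2.1.eval (s.2.2 j) ≠ 0}
  -- Including the inverses makes `Q(z j)` a unit of the algebra, hence nonzero in every residue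
  -- field.
  let F : (Fin n ⊕ Fin n) ⊕ (Fin (2 * n) ⊕ Fin (2 * n)) → S → ℂ :=
    Sum.elim (Sum.elim (fun i s => s.1.1.coeff i) (fun i s => s.1.2.1.coeff i))
      (Sum.elim (fun j s => s.1.2.2 j) (fun j s => (s.1.2.1.eval (s.1.2.2 j))⁻¹))
  have hPs (s : S) : s.1.1 = X ^ (n + 1) + ∑ k : Fin n, C (s.1.1.coeff k) * X ^ (k : ℕ) := by
    refine eq_X_pow_add_sum_fin s.2.1.monic_P s.2.1.natDegree_P n.le_succ fun k h1 h2 => ?_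
    obtain rfl : k = n := by omega
    exact s.2.1.coeff_P
  have hQs (s : S) : s.1.2.1 = X ^ n + ∑ k : Fin n, C (s.1.2.1.coeff k) * X ^ (k : ℕ) :=
    eq_X_pow_add_sum_fin s.2.1.monic_Q s.2.1.natDegree_Q le_rfl fun k h1 h2 => by omega
  refine Set.finite_coe_iff.1 (finite_of_derivation_coordinates_eq_zero F ?_ ?_)
  · intro s t h
    refine Subtype.ext (Prod.ext ?_ (Prod.ext ?_ (funext fun j => h (.inr (.inl j)))))
    · rw [hPs s, hPs t]
      congr! 4 with k
      exact h (.inl (.inl k))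
    · rw [hQs s, hQs t]
      congr! 4 with k
      exact h (.inl (.inr k))
  · intro K _ _ _ _ _ D
    let A := Algebra.adjoin ℂ (Set.range F)
    let g (i) : A := ⟨F i, Algebra.subset_adjoin ⟨i, rfl⟩⟩
    let p (i : Fin n) := g (.inl (.inl i))
    let q (i : Fin n) := g (.inl (.inr i))
    let z (j : Fin (2 * n)) := g (.inr (.inl j))
    let u (j : Fin (2 * n)) := g (.inr (.inr j))
    let P : A[X] := X ^ (n + 1) + ∑ k : Fin n, C (p k) * X ^ (k : ℕ)
    let Q : A[X] := X ^ n + ∑ k : Fin n, C (q k) * X ^ (k : ℕ)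
    let ev (s : S) : A →ₐ[ℂ] ℂ := (Pi.evalAlgHom ℂ (fun _ : S => ℂ) s).comp A.val
    -- Elements of `A` are functions on `S`, so the equations over `A` may be checked at each
    -- solution.
    have hext {a b : A} (h : ∀ s, ev s a = ev s b) : a = b := Subtype.ext (funext h)
    have hP (s : S) : P.map (ev s : A →+* ℂ) = s.1.1 := by
      rw [hPs s]
      simp [P, Polynomial.map_sum, ev, p, g, F]
    have hQ (s : S) : Q.map (ev s : A →+* ℂ) = s.1.2.1 := by
      rw [hQs s]
      simp [Q, Polynomial.map_sum, ev, q, g, F]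
    have hev (s : S) (f : A[X]) (j) :
        ev s (f.eval (z j)) = (f.map (ev s : A →+* ℂ)).eval (s.1.2.2 j) := by
      rw [eval_map]
      exact (eval₂_at_apply (ev s : A →+* ℂ) (z j)).symm
    obtain ⟨h1, h2, h3, h4⟩ := derivation_eq_zero_of_critVal hζ p q z u (P := P) (Q := Q) rfl rfl
      (fun j => hext fun s => by
        rw [map_mul, hev, hQ, map_one]
        exact inv_mul_cancel₀ (s.2.2 j))
      (fun j => hext fun s => by
        rw [map_sub, map_mul, hev, hev, hP, hQ, AlgHom.commutes, map_zero]
        exact s.2.1.critVal j)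
      (fun j => hext fun s => by
        rw [map_sub, map_mul, map_mul, hev, hev, hev, hev, ← derivative_map, ← derivative_map,
          hP, hQ, map_zero]
        exact s.2.1.critPt j) D
    rintro ((i | i) | (j | j))
    exacts [h1 i, h2 i, h3 j, h4 j]
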